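/- Let $W$ take values in a standard Borel space $\mathcal W$ with prior $P_W$, and let $P^w_{XY}$, $w\in\mathcal W$, be a Markov kernel from $\mathcal W$ to $\mathcal X\times\mathcal Y$ ($\mathcal X$, $\mathcal Y$ measurable spaces). Given $W=w$, the training set $Z^n=((X_1,Y_1),\dots,(X_n,Y_n))$ consists of $n$ i.i.d. samples of $P^w_{XY}$. Let $\ell:\mathcal Y\times\mathcal Y\to\mathbb R$ be a measurable loss. Let $\mathcal H$ be a class of functions $\mathcal X\to\mathcal Y$ with a $\sigma$-algebra for which $(h,x)\mapsto h(x)$ is measurable. Assume that $\psi^*:\mathcal W\times\mathcal X\to\mathcal Y$ minimizes $\mathbb E[\ell(Y,\psi(W,X))]$ over measurable $\psi$ (that is, $\mathbb E[\ell(Y,\psi(W,X))-\ell(Y,\psi^*(W,X))]\ge 0$ for every measurable $\psi$ for which this difference is integrable), that $h^*_w=\psi^*(w,\cdot)\in\mathcal H$ for all $w$, and that $w\mapsto h^*_w\in\mathcal H$ is measurable. Define $$d(w,h)=\mathbb E^{w}_{XY}\big[\ell(Y,h(X))-\ell(Y,h^*_w(X))\big]\qquad(w\in\mathcal W,\ h\in\mathcal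 H).$$ For $R\ge 0$ define, with values in $[0,\infty]$, $$D^L(R)=\inf_{P^{W}_{\hat h}:\ I(W;\hat h)\le R}\mathbb E[d(W,\hat h)],\qquad D_n(R)=\inf_{P^{Z^n}_{\hat h}:\ I(W;\hat h)\le R}\mathbb E[d(W,\hat h)],\qquad D^U_n(R)=\inf_{P^{Z^n}_{\hat h}:\ I(Z^n;\hat h)\le R}\mathbb E[d(W,\hat h)],$$ where $P^{W}_{\hat h}$ (respectively $P^{Z^n}_{\hat h}$) ranges over the Markov kernels from $\mathcal W$ (respectively $(\mathcal X\times\mathcal Y)^n$) to $\mathcal H$, where $W - Z^n - \hat h$ is a Markov chain in the second and third problem, and where $I(A;B)=\mathrm{KL}(P_{AB}\,\|\,P_A\otimes P_B)$. Theorem. Suppose that there is a (pseudo-)distance $d'$ on $\mathcal H$ such that for all $w\in\mathcal W$ and $h\in\mathcal H$ the expectation defining $d(w,h)$ exists (its integrand is integrable) and $d(w,h)=d'(h^*_w,h)$. For each $n$ let $W,W'$ be, given $Z^n$, two independent draws from the posterior distribution of the parameter given $Z^n$. If $$\lim_{n\to\infty}\mathbb E\big[d'(h^*_W,h^*_{W'})\big]=0,$$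 then for every $R\ge 0$ $$D^L(R)=\lim_{n\to\infty}D_n(R)=\lim_{n\to\infty}D^U_n(R).$$ -/

import Mathlib

open MeasureTheory ProbabilityTheory InformationTheory Filter Topology
open scoped ENNReal NNReal

namespace BayesRD

noncomputable section

/-- Mutual information `I(A;B)`, in nats, of a pair `(A,B)` with joint law `ρ`: the
Kullback-Leibler divergence of `ρ` from the product of its marginals. -/
def mutualInfo {α β : Type*} [MeasurableSpace α] [MeasurableSpace β] (ρ : Measure (α × β)) :
    ℝ≥0∞ :=
  klDiv ρ (ρ.fst.prod ρ.snd)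

section Model

variable {𝒲 𝒳 𝒴 𝓗 : Type*} [MeasurableSpace 𝒲] [MeasurableSpace 𝒳] [MeasurableSpace 𝒴]
  [MeasurableSpace 𝓗]

theorem measurable_pi_const (P : Kernel 𝒲 (𝒳 × 𝒴)) [IsMarkovKernel P] (n : ℕ) :
    Measurable (fun w => Measure.pi (fun _ : Fin n => P w)) := by
  refine Measurable.measure_of_isPiSystem_of_isProbabilityMeasure generateFrom_pi.symm
    isPiSystem_pi ?_
  rintro _ ⟨s, hs, rfl⟩
  simp only [Measure.pi_pi]
  exact Finset.measurable_prod _ fun i _ => P.measurable_coe (hs i (Set.mem_univ i))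

/-- The law of the training set given the parameter: given `W = w`, the set `Z^n` consists of
`n` i.i.d. samples `(X_i, Y_i)` of `P w`. -/
def sampleKernel (P : Kernel 𝒲 (𝒳 × 𝒴)) [IsMarkovKernel P] (n : ℕ) :
    Kernel 𝒲 (Fin n → 𝒳 × 𝒴) where
  toFun w := Measure.pi (fun _ => P w)
  measurable' := measurable_pi_const P n

instance (P : Kernel 𝒲 (𝒳 × 𝒴)) [IsMarkovKernel P] (n : ℕ) :
    IsMarkovKernel (sampleKernel P n) :=
  ⟨fun w => inferInstanceAs (IsProbabilityMeasure (Measure.pi (fun _ : Fin n => P w)))⟩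

/-- The (marginal) law of the training set `Z^n`. -/
def dataLaw (prior : Measure 𝒲) (P : Kernel 𝒲 (𝒳 × 𝒴)) [IsMarkovKernel P] (n : ℕ) :
    Measure (Fin n → 𝒳 × 𝒴) :=
  sampleKernel P n ∘ₘ prior

/-- `ψ` is a Bayes decision rule for predicting `Y` from `(W, X)`: it minimizes
`E[ℓ(Y, ψ(W, X))]` over all measurable rules. The comparison is made on the expected difference
of the losses, so that the minimal risk itself need not be finite. -/
def IsBayesDecision (prior : Measure 𝒲) (P : Kernel 𝒲 (𝒳 × 𝒴)) (ℓ : 𝒴 → 𝒴 → ℝ)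
    (ψ : 𝒲 → 𝒳 → 𝒴) : Prop :=
  Measurable (Function.uncurry ψ) ∧
    ∀ φ : 𝒲 → 𝒳 → 𝒴, Measurable (Function.uncurry φ) →
      Integrable (fun p : 𝒲 × 𝒳 × 𝒴 => ℓ p.2.2 (φ p.1 p.2.1) - ℓ p.2.2 (ψ p.1 p.2.1))
        (prior ⊗ₘ P) →
      0 ≤ ∫ p, (ℓ p.2.2 (φ p.1 p.2.1) - ℓ p.2.2 (ψ p.1 p.2.1)) ∂(prior ⊗ₘ P)

/-- The distortion `d(w, h) = E_{XY}^w [ℓ(Y, h(X)) - ℓ(Y, h*_w(X))]`. -/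
def distortion [FunLike 𝓗 𝒳 𝒴] (P : Kernel 𝒲 (𝒳 × 𝒴)) (ℓ : 𝒴 → 𝒴 → ℝ) (hstar : 𝒲 → 𝓗)
    (w : 𝒲) (h : 𝓗) : ℝ :=
  ∫ z, (ℓ z.2 (h z.1) - ℓ z.2 (hstar w z.1)) ∂(P w)

/-- The distortion is the distance from `h*_w`: for all `w` and `h` the expectation that defines
`d(w, h)` exists, and it is equal to `d'(h*_w, h)`, where `d'` is `dist`. -/
def DistortionIsDist [FunLike 𝓗 𝒳 𝒴] [PseudoMetricSpace 𝓗] (P : Kernel 𝒲 (𝒳 × 𝒴))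
    (ℓ : 𝒴 → 𝒴 → ℝ) (hstar : 𝒲 → 𝓗) : Prop :=
  ∀ (w : 𝒲) (h : 𝓗),
    Integrable (fun z : 𝒳 × 𝒴 => ℓ z.2 (h z.1) - ℓ z.2 (hstar w z.1)) (P w) ∧
      distortion P ℓ hstar w h = dist (hstar w) h

/-- The expected distortion `E[d(W, h)]`, in `[0, ∞]`, when `(W, h)` has the joint law `ρ`.
It is used for nonnegative distortions only. -/
def expDistortion [FunLike 𝓗 𝒳 𝒴] (P : Kernel 𝒲 (𝒳 × 𝒴)) (ℓ : 𝒴 → 𝒴 → ℝ)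
    (hstar : 𝒲 → 𝓗) (ρ : Measure (𝒲 × 𝓗)) : ℝ≥0∞ :=
  ∫⁻ p, ENNReal.ofReal (distortion P ℓ hstar p.1 p.2) ∂ρ

/-- The lower rate-distortion function `D^L(R)`: the infimum of `E[d(W, h)]` over all conditional
laws `η` of `h` given `W` with `I(W; h) ≤ R`. -/
def lowerRD [FunLike 𝓗 𝒳 𝒴] (prior : Measure 𝒲) (P : Kernel 𝒲 (𝒳 × 𝒴)) (ℓ : 𝒴 → 𝒴 → ℝ)
    (hstar : 𝒲 → 𝓗) (R : ℝ≥0) : ℝ≥0∞ :=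
  ⨅ (η : Kernel 𝒲 𝓗) (_ : IsMarkovKernel η) (_ : mutualInfo (prior ⊗ₘ η) ≤ R),
    expDistortion P ℓ hstar (prior ⊗ₘ η)

/-- The constrained rate-distortion function `D_n(R)`: the infimum of `E[d(W, h)]` over all
conditional laws `η` of `h` given `Z^n` with `I(W; h) ≤ R`, where `W - Z^n - h` is Markov. -/
def constrainedRD [FunLike 𝓗 𝒳 𝒴] (prior : Measure 𝒲) (P : Kernel 𝒲 (𝒳 × 𝒴))
    [IsMarkovKernel P] (ℓ : 𝒴 → 𝒴 → ℝ) (hstar : 𝒲 → 𝓗) (n : ℕ) (R : ℝ≥0) : ℝ≥0∞ :=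
  ⨅ (η : Kernel (Fin n → 𝒳 × 𝒴) 𝓗) (_ : IsMarkovKernel η)
    (_ : mutualInfo (prior ⊗ₘ (η ∘ₖ sampleKernel P n)) ≤ R),
    expDistortion P ℓ hstar (prior ⊗ₘ (η ∘ₖ sampleKernel P n))

/-- The upper rate-distortion function `D^U_n(R)`: the infimum of `E[d(W, h)]` over all
conditional laws `η` of `h` given `Z^n` with `I(Z^n; h) ≤ R`, where `W - Z^n - h` is Markov. -/
def upperRD [FunLike 𝓗 𝒳 𝒴] (prior : Measure 𝒲) (P : Kernel 𝒲 (𝒳 × 𝒴))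
    [IsMarkovKernel P] (ℓ : 𝒴 → 𝒴 → ℝ) (hstar : 𝒲 → 𝓗) (n : ℕ) (R : ℝ≥0) : ℝ≥0∞ :=
  ⨅ (η : Kernel (Fin n → 𝒳 × 𝒴) 𝓗) (_ : IsMarkovKernel η)
    (_ : mutualInfo (dataLaw prior P n ⊗ₘ η) ≤ R),
    expDistortion P ℓ hstar (prior ⊗ₘ (η ∘ₖ sampleKernel P n))

/-- The joint law of `(W, W')`, where, given `Z^n`, the variables `W` and `W'` are drawn
independently from the posterior distribution of the parameter given `Z^n`. -/
def posteriorPairLaw [StandardBorelSpace 𝒲] [Nonempty 𝒲] (prior : Measure 𝒲)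
    [IsFiniteMeasure prior] (P : Kernel 𝒲 (𝒳 × 𝒴)) [IsMarkovKernel P] (n : ℕ) :
    Measure (𝒲 × 𝒲) :=
  (posterior (sampleKernel P n) prior ×ₖ posterior (sampleKernel P n) prior) ∘ₘ
    dataLaw prior P n

end Model

end

end BayesRD

namespace BayesRD

section DataProcessing

variable {α β γ : Type*} [MeasurableSpace α] [MeasurableSpace β] [MeasurableSpace γ]

/-! The limits follow by squeezing from `D^L ≤ D_n ≤ D^U_n ≤ D^L + E[d'(h*_W, h*_W')]`. A kernel
from the data induces one from `W`, and data processing along `W - Z^n - h` gives `I(W;h) ≤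
I(Z^n;h)`; these are the first two inequalities. For the third, take `η` feasible for `D^L`, sample
`W'` from the posterior and draw `h` from `η W'`. As `(W', Z^n)` has the law of `(W, Z^n)`, also
`Z^n - W' - h` is Markov, so `I(Z^n;h) ≤ I(W';h) ≤ R` (`mutualInfo_compProd_comp_posterior_le`). The
triangle inequality through `h*_W'` bounds the excess cost (`lintegral_compProd_comp_posterior_le`).
-/

theorem fst_parallelComp_id_comp (κ : Kernel α γ) [IsMarkovKernel κ] (ρ : Measure (α × β)) :
    ((κ ∥ₖ (Kernel.id : Kernel β β)) ∘ₘ ρ).fst = κ ∘ₘ ρ.fst := by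
  have h : (κ ∥ₖ (Kernel.id : Kernel β β)).map Prod.fst
      = κ ∘ₖ Kernel.deterministic Prod.fst measurable_fst := by
    ext a : 1
    rw [Kernel.map_apply _ measurable_fst, Kernel.parallelComp_apply, Measure.map_fst_prod,
      Kernel.comp_deterministic_eq_comap, Kernel.comap_apply, measure_univ, one_smul]
  rw [Measure.fst, Measure.map_comp _ _ measurable_fst, h, ← Measure.comp_assoc,
    Measure.deterministic_comp_eq_map, Measure.fst]

theorem snd_parallelComp_id_comp (κ : Kernel α γ) [IsMarkovKernel κ] (ρ : Measure (α × β)) :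
    ((κ ∥ₖ (Kernel.id : Kernel β β)) ∘ₘ ρ).snd = ρ.snd := by
  have h : (κ ∥ₖ (Kernel.id : Kernel β β)).map Prod.snd
      = Kernel.deterministic Prod.snd measurable_snd := by
    ext a : 1
    rw [Kernel.map_apply _ measurable_snd, Kernel.parallelComp_apply, Measure.map_snd_prod,
      measure_univ, one_smul, Kernel.id_apply, Kernel.deterministic_apply]
  rw [Measure.snd, Measure.map_comp _ _ measurable_snd, h,
    Measure.deterministic_comp_eq_map, Measure.snd]

/-- Data processing inequality for the mutual information: processing the first variable by a
Markov kernel does not increase it. -/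
theorem mutualInfo_parallelComp_id_le (κ : Kernel α γ) [IsMarkovKernel κ] (ρ : Measure (α × β))
    [IsFiniteMeasure ρ] :
    mutualInfo ((κ ∥ₖ (Kernel.id : Kernel β β)) ∘ₘ ρ) ≤ mutualInfo ρ := by
  -- The same kernel `κ ∥ₖ id` carries the joint law and the product of its marginals to their
  -- counterparts, so contraction of `klDiv` under a kernel applies.
  rw [mutualInfo, mutualInfo, fst_parallelComp_id_comp, snd_parallelComp_id_comp,
    Measure.prod_comp_left]
  exact klDiv_comp_right_le _ _ _

end DataProcessing

section Posterior

variable {α β γ : Type*} [MeasurableSpace α] [StandardBorelSpace α] [Nonempty α]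
  [MeasurableSpace β] [MeasurableSpace γ]
  (μ : Measure α) [IsFiniteMeasure μ] (κ : Kernel α β) [IsMarkovKernel κ]

/-- Bayes' rule: along `A - B - C`, the ends are independent given `B`. -/
theorem compProd_comp_eq_posterior_prod_comp (η : Kernel β γ) [IsMarkovKernel η] :
    μ ⊗ₘ (η ∘ₖ κ) = (κ†μ ×ₖ η) ∘ₘ (κ ∘ₘ μ) := by
  rw [← Measure.parallelComp_comp_compProd, ← posterior_prod_id_comp, Measure.comp_assoc,
    Kernel.parallelComp_comp_prod, Kernel.id_comp, Kernel.comp_id]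

/-- If `A - B - C` is a Markov chain, then `(A, C)` is obtained from `(B, C)` by drawing `A` from
its posterior given `B`. -/
theorem compProd_comp_eq_parallelComp_comp (η : Kernel β γ) [IsMarkovKernel η] :
    μ ⊗ₘ (η ∘ₖ κ) = (κ†μ ∥ₖ (Kernel.id : Kernel γ γ)) ∘ₘ ((κ ∘ₘ μ) ⊗ₘ η) := by
  rw [compProd_comp_eq_posterior_prod_comp, Measure.compProd_eq_comp_prod,
    Measure.comp_assoc (κ := Kernel.id ×ₖ η),
    Kernel.parallelComp_comp_prod, Kernel.id_comp, Kernel.comp_id]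

/-- Bayes' rule reversed: `B` can be regenerated from the posterior draw `A'` by `κ`, independently
of `C` given `A'`. -/
theorem compProd_comp_posterior_eq_parallelComp_comp (η : Kernel α γ) [IsMarkovKernel η] :
    (κ ∘ₘ μ) ⊗ₘ (η ∘ₖ κ†μ) = (κ ∥ₖ (Kernel.id : Kernel γ γ)) ∘ₘ (μ ⊗ₘ η) := by
  rw [← Measure.parallelComp_comp_compProd, compProd_posterior_eq_swap_comp,
    Measure.compProd_eq_comp_prod μ κ, Measure.compProd_eq_comp_prod μ η,
    Measure.comp_assoc (κ := Kernel.id ×ₖ κ), Kernel.swap_prod, Measure.comp_assoc,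
    Measure.comp_assoc, Kernel.parallelComp_comp_prod, Kernel.parallelComp_comp_prod,
    Kernel.id_comp, Kernel.comp_id, Kernel.comp_id, Kernel.id_comp]

/-- Data processing inequality for a Markov chain `A - B - C`: `I(A; C) ≤ I(B; C)`. -/
theorem mutualInfo_compProd_comp_le (η : Kernel β γ) [IsMarkovKernel η] :
    mutualInfo (μ ⊗ₘ (η ∘ₖ κ)) ≤ mutualInfo ((κ ∘ₘ μ) ⊗ₘ η) := by
  rw [compProd_comp_eq_parallelComp_comp]
  exact mutualInfo_parallelComp_id_le _ _

/-- If `A'` is drawn from the posterior given `B`, and `C` is drawn given `A'`, then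
`I(B; C) ≤ I(A'; C)`. -/
theorem mutualInfo_compProd_comp_posterior_le (η : Kernel α γ) [IsMarkovKernel η] :
    mutualInfo ((κ ∘ₘ μ) ⊗ₘ (η ∘ₖ κ†μ)) ≤ mutualInfo (μ ⊗ₘ η) := by
  rw [compProd_comp_posterior_eq_parallelComp_comp]
  exact mutualInfo_parallelComp_id_le _ _

theorem snd_posterior_prod_posterior_comp :
    ((κ†μ ×ₖ κ†μ) ∘ₘ (κ ∘ₘ μ)).snd = μ := by
  rw [Measure.snd, Measure.map_comp _ _ measurable_snd, ← Kernel.snd_eq, Kernel.snd_prod,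
    posterior_comp_self]

/-- Triangle inequality for expected costs: replacing `A` by an independent draw `A'` from the
posterior given `B` costs at most `E[g(A, A')]`. -/
theorem lintegral_compProd_comp_posterior_le (η : Kernel α γ) [IsMarkovKernel η]
    {f : α × γ → ℝ≥0∞} (hf : Measurable f) {g : α × α → ℝ≥0∞}
    (hfg : ∀ a a' c, f (a, c) ≤ g (a, a') + f (a', c)) :
    ∫⁻ p, f p ∂(μ ⊗ₘ (η ∘ₖ κ†μ ∘ₖ κ))
      ≤ ∫⁻ p, g p ∂((κ†μ ×ₖ κ†μ) ∘ₘ (κ ∘ₘ μ)) + ∫⁻ p, f p ∂(μ ⊗ₘ η) := by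
  set T := (κ†μ ×ₖ κ†μ) ∘ₘ (κ ∘ₘ μ) with hT
  -- `T` is the law of `(A, A')`; `C` depends on this pair only through `A'`.
  have hlaw : μ ⊗ₘ (η ∘ₖ κ†μ ∘ₖ κ) = ((Kernel.id : Kernel α α) ∥ₖ η) ∘ₘ T := by
    rw [compProd_comp_eq_posterior_prod_comp, hT, Measure.comp_assoc (κ := κ†μ ×ₖ κ†μ),
      Kernel.parallelComp_comp_prod, Kernel.id_comp]
  have hF : Measurable fun a => ∫⁻ c, f (a, c) ∂(η a) := hf.lintegral_kernel_prod_right'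
  calc ∫⁻ p, f p ∂(μ ⊗ₘ (η ∘ₖ κ†μ ∘ₖ κ))
      = ∫⁻ p, ∫⁻ c, f (p.1, c) ∂(η p.2) ∂T := by
        rw [hlaw, Measure.lintegral_bind (Kernel.aemeasurable _) hf.aemeasurable]
        refine lintegral_congr fun p => ?_
        rw [Kernel.parallelComp_apply, lintegral_prod _ hf.aemeasurable, Kernel.id_apply,
          lintegral_dirac' _ hf.lintegral_prod_right']
    _ ≤ ∫⁻ p, (g p + ∫⁻ c, f (p.2, c) ∂(η p.2)) ∂T := by
        refine lintegral_mono fun p => ?_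
        calc ∫⁻ c, f (p.1, c) ∂(η p.2) ≤ ∫⁻ c, (g p + f (p.2, c)) ∂(η p.2) :=
              lintegral_mono fun c => hfg p.1 p.2 c
          _ = g p + ∫⁻ c, f (p.2, c) ∂(η p.2) := by
              rw [lintegral_add_left measurable_const, lintegral_const, measure_univ, mul_one]
    _ = ∫⁻ p, g p ∂T + ∫⁻ p, ∫⁻ c, f (p.2, c) ∂(η p.2) ∂T :=
        -- Measurability of the second summand suffices, so `g` can be arbitrary.
        lintegral_add_right _ (hF.comp measurable_snd)
    _ = ∫⁻ p, g p ∂T + ∫⁻ p, f p ∂(μ ⊗ₘ η) := by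
        -- `A'` has law `μ`, so its cost is that of `η` under the prior.
        rw [Measure.lintegral_compProd hf]
        conv_rhs => rw [← snd_posterior_prod_posterior_comp μ κ, Measure.snd,
          lintegral_map hF measurable_snd]

end Posterior

section RateDistortion

variable {𝒲 𝒳 𝒴 𝓗 : Type*} [MeasurableSpace 𝒲] [MeasurableSpace 𝒳] [MeasurableSpace 𝒴]
  [MeasurableSpace 𝓗] [FunLike 𝓗 𝒳 𝒴]

theorem measurable_distortion (h_eval : Measurable (fun p : 𝓗 × 𝒳 => p.1 p.2))
    (P : Kernel 𝒲 (𝒳 × 𝒴)) [IsMarkovKernel P] {ℓ : 𝒴 → 𝒴 → ℝ}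
    (h_loss : Measurable (Function.uncurry ℓ)) {hstar : 𝒲 → 𝓗} (h_star_meas : Measurable hstar) :
    Measurable (fun p : 𝒲 × 𝓗 => distortion P ℓ hstar p.1 p.2) := by
  have h1 : Measurable (fun q : (𝒲 × 𝓗) × (𝒳 × 𝒴) => ℓ q.2.2 (q.1.2 q.2.1)) :=
    h_loss.comp (measurable_snd.snd.prodMk
      (h_eval.comp (measurable_fst.snd.prodMk measurable_snd.fst)))
  have h2 : Measurable (fun q : (𝒲 × 𝓗) × (𝒳 × 𝒴) => ℓ q.2.2 (hstar q.1.1 q.2.1)) :=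
    h_loss.comp (measurable_snd.snd.prodMk
      (h_eval.comp ((h_star_meas.comp measurable_fst.fst).prodMk measurable_snd.fst)))
  exact ((h1.sub h2).stronglyMeasurable.integral_kernel_prod_right'
    (κ := P.comap Prod.fst measurable_fst)).measurable

theorem lowerRD_le_constrainedRD (prior : Measure 𝒲) (P : Kernel 𝒲 (𝒳 × 𝒴))
    [IsMarkovKernel P] (ℓ : 𝒴 → 𝒴 → ℝ) (hstar : 𝒲 → 𝓗) (n : ℕ) (R : ℝ≥0) :
    lowerRD prior P ℓ hstar R ≤ constrainedRD prior P ℓ hstar n R :=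
  le_iInf fun η => le_iInf fun _ => le_iInf fun hR =>
    iInf_le_of_le (η ∘ₖ sampleKernel P n) <| iInf_le_of_le inferInstance <| iInf_le _ hR

variable [StandardBorelSpace 𝒲] [Nonempty 𝒲]

theorem constrainedRD_le_upperRD (prior : Measure 𝒲) [IsProbabilityMeasure prior]
    (P : Kernel 𝒲 (𝒳 × 𝒴)) [IsMarkovKernel P] (ℓ : 𝒴 → 𝒴 → ℝ) (hstar : 𝒲 → 𝓗) (n : ℕ)
    (R : ℝ≥0) :
    constrainedRD prior P ℓ hstar n R ≤ upperRD prior P ℓ hstar n R :=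
  le_iInf fun η => le_iInf fun hη => le_iInf fun hR =>
    iInf_le_of_le η <| iInf_le_of_le hη <|
      iInf_le _ ((mutualInfo_compProd_comp_le prior (sampleKernel P n) η).trans hR)

/-- Drawing `W'` from the posterior given `Z^n`, and the hypothesis from a conditional law given
the parameter applied to `W'`, costs at most `E[d'(h*_W, h*_W')]`. -/
theorem upperRD_le_add_lowerRD [PseudoMetricSpace 𝓗]
    (h_eval : Measurable (fun p : 𝓗 × 𝒳 => p.1 p.2))
    (prior : Measure 𝒲) [IsProbabilityMeasure prior]
    (P : Kernel 𝒲 (𝒳 × 𝒴)) [IsMarkovKernel P] {ℓ : 𝒴 → 𝒴 → ℝ}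
    (h_loss : Measurable (Function.uncurry ℓ)) {hstar : 𝒲 → 𝓗} (h_star_meas : Measurable hstar)
    (h_dist : DistortionIsDist P ℓ hstar) (n : ℕ) (R : ℝ≥0) :
    upperRD prior P ℓ hstar n R
      ≤ ∫⁻ p, ENNReal.ofReal (dist (hstar p.1) (hstar p.2)) ∂(posteriorPairLaw prior P n)
        + lowerRD prior P ℓ hstar R := by
  simp only [lowerRD, ENNReal.add_iInf]
  refine le_iInf fun η => le_iInf fun _ => le_iInf fun hR => ?_
  refine iInf_le_of_le (η ∘ₖ (sampleKernel P n)†prior) <| iInf_le_of_le inferInstance <|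
    iInf_le_of_le ((mutualInfo_compProd_comp_posterior_le prior (sampleKernel P n) η).trans hR) ?_
  refine lintegral_compProd_comp_posterior_le prior (sampleKernel P n) η
    (measurable_distortion h_eval P h_loss h_star_meas).ennreal_ofReal fun w w' h => ?_
  rw [(h_dist w h).2, (h_dist w' h).2, ← ENNReal.ofReal_add dist_nonneg dist_nonneg]
  exact ENNReal.ofReal_le_ofReal (dist_triangle _ _ _)

end RateDistortion

end BayesRD

theorem mainTheorem3 {𝒲 𝒳 𝒴 𝓗 : Type*}
    [MeasurableSpace 𝒲] [StandardBorelSpace 𝒲] [Nonempty 𝒲]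
    [MeasurableSpace 𝒳] [MeasurableSpace 𝒴]
    -- a class of functions from `𝒳` to `𝒴`, with a `σ`-algebra and a distance
    [MeasurableSpace 𝓗] [FunLike 𝓗 𝒳 𝒴] [PseudoMetricSpace 𝓗]
    (h_eval : Measurable (fun p : 𝓗 × 𝒳 => p.1 p.2))
    (prior : Measure 𝒲) [IsProbabilityMeasure prior]
    (P : Kernel 𝒲 (𝒳 × 𝒴)) [IsMarkovKernel P]
    (ℓ : 𝒴 → 𝒴 → ℝ) (h_loss : Measurable (Function.uncurry ℓ))
    -- the Bayes decision functions `h*_w`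
    (hstar : 𝒲 → 𝓗) (h_star_meas : Measurable hstar)
    (h_bayes : BayesRD.IsBayesDecision prior P ℓ (fun w x => hstar w x))
    (h_dist : BayesRD.DistortionIsDist P ℓ hstar)
    (h_post : Tendsto
      (fun n => ∫⁻ p, ENNReal.ofReal (dist (hstar p.1) (hstar p.2))
        ∂(BayesRD.posteriorPairLaw prior P n)) atTop (𝓝 0)) :
    ∀ R : ℝ≥0,
      Tendsto (fun n => BayesRD.constrainedRD prior P ℓ hstar n R) atTop
        (𝓝 (BayesRD.lowerRD prior P ℓ hstar R)) ∧
      Tendsto (fun n => BayesRD.upperRD prior P ℓ hstar n R) atTop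
        (𝓝 (BayesRD.lowerRD prior P ℓ hstar R)) := by
  intro R
  have h_upper : Tendsto (fun n =>
      ∫⁻ p, ENNReal.ofReal (dist (hstar p.1) (hstar p.2))
          ∂(BayesRD.posteriorPairLaw prior P n)
        + BayesRD.lowerRD prior P ℓ hstar R) atTop (𝓝 (BayesRD.lowerRD prior P ℓ hstar R)) := by
    simpa using h_post.add_const (BayesRD.lowerRD prior P ℓ hstar R)
  have h_le n := BayesRD.lowerRD_le_constrainedRD prior P ℓ hstar n R
  have h_le' n := BayesRD.constrainedRD_le_upperRD prior P ℓ hstar n R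
  have h_le'' n :=
    BayesRD.upperRD_le_add_lowerRD h_eval prior P h_loss h_star_meas h_dist n R
  exact ⟨tendsto_of_tendsto_of_tendsto_of_le_of_le tendsto_const_nhds h_upper h_le
      fun n => (h_le' n).trans (h_le'' n),
    tendsto_of_tendsto_of_tendsto_of_le_of_le tendsto_const_nhds h_upper
      (fun n => (h_le n).trans (h_le' n)) h_le''⟩
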